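/- Let $q\in[0,1/2]$. The balanced community modulated random recursive tree BCMRT$(q)$ is the following growing sequence of random trees $(T_n)_{n\ge 1}$. The tree $T_1$ is a single edge joining two nodes $(1,A)$ and $(1,B)$. For $n\ge 2$, $T_n$ is obtained from $T_{n-1}$ by adding two nodes $(n,A)$ and $(n,B)$, where, independently of each other and of the past, each new node $(n,\Lambda)$ selects its own type $\Lambda$ with probability $1-q$ and the other type with probability $q$, and is then joined by an edge to a uniformly chosen node of the selected type among the nodes of $T_{n-1}$. Thus $T_n$ has $2n$ nodes. For an edge $e$ of $T_n$ let $T_n^{e_+}$ and $T_n^{e_-}$ be the two subtrees obtained by removing $e$, let $|\cdot|$ denote the number of nodes, and put $$S_n=\sum_{e\in E(T_n)}|T_n^{e_+}|\,|T_n^{e_-}|,$$ which is the sum of the distances over all unordered pairs of nodes of $T_n$. Then, for every $q\in[0,1/2]$, $$\operatorname{Var}_q(S_n)=O(n^4)\qquad\text{as } n\to\infty .$$ -/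

import Mathlib

open MeasureTheory ProbabilityTheory Asymptotics Filter

namespace BCMRT

/-- The nodes of a tree of size `2n`. The pair `(k, Λ)` is the node with time-label `k + 1` and
type `Λ`, the two types `A` and `B` being the two Booleans. -/
abbrev Node (n : ℕ) : Type := Fin n × Bool

/-- The nodes with time-label at least `2`: those that have to choose a parent. -/
abbrev NonRoot (n : ℕ) : Type := {v : Node n // 0 < v.1.val}

/-- The choices made by all nodes with time-label at least `2`. A node with time-label `k + 1`
makes a choice `(b, u)`: the Boolean `b` says whether it attaches to the other type
(`true`: other type, `false`: own type), and `u ∈ {0, …, k - 1}` says that its parent has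
time-label `u + 1`. Before its arrival there is exactly one node of each type
with each of the time-labels `1, …, k`. -/
abbrev Choices (n : ℕ) : Type := ∀ v : NonRoot n, Bool × Fin v.1.1.val

/-- The law of the choices: all are independent, `b` is Bernoulli with parameter `q`, and `u` is
independent of `b` and uniform. -/
noncomputable def law (q : unitInterval) (n : ℕ) : Measure (Choices n) :=
  Measure.pi fun _ => (bernoulliMeasure true false q).prod (uniformOn Set.univ)

/-- The parent of a node with time-label at least `2`. -/
def parent {n : ℕ} (ω : Choices n) (v : NonRoot n) : Node n :=
  (⟨(ω v).2.val, (ω v).2.isLt.trans v.1.1.isLt⟩, xor v.1.2 (ω v).1)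

/-- The tree `T_n`: the two nodes with time-label `1` are joined by an edge,
and each other node is joined to its parent. -/
def tree {n : ℕ} (ω : Choices n) : SimpleGraph (Node n) :=
  SimpleGraph.fromRel fun x y =>
    (x.1.val = 0 ∧ y.1.val = 0) ∨ ∃ h : 0 < x.1.val, y = parent ω ⟨x, h⟩

/-- The number of vertices of the connected component of `v` after removal of the edge `e`. -/
noncomputable def sideSize {V : Type*} (G : SimpleGraph V) (e : Sym2 V) (v : V) : ℕ :=
  {w : V | (G.deleteEdges {e}).Reachable v w}.ncard

/-- The product of the sizes of the components of the two endpoints of `e` after removal of `e`. -/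
noncomputable def edgeProduct {V : Type*} (G : SimpleGraph V) (e : Sym2 V) : ℕ :=
  Sym2.lift ⟨fun x y => sideSize G s(x, y) x * sideSize G s(x, y) y,
    fun x y => by simp only [Sym2.eq_swap (a := x) (b := y), mul_comm]⟩ e

open Classical in
/-- The sum over all edges `e` of the product of the sizes of the two subtrees
separated by `e`. -/
noncomputable def edgeSum {V : Type*} [Fintype V] (G : SimpleGraph V) : ℕ :=
  ∑ e ∈ G.edgeFinset, edgeProduct G e

/-- The random variable `S_n`. -/
noncomputable def S (n : ℕ) (ω : Choices n) : ℝ := (edgeSum (tree ω) : ℝ)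

end BCMRT

/-!
Let `W_n = 2 * S_n` be the sum of the distances over all ordered pairs of nodes of `T_n`, the
distance of two nodes being the number of edges that separate them (`two_mul_edgeSum`). Attaching
the two new nodes as leaves at nodes `u` and `u'` gives
`W_{n+1} = W_n + 2 * (d(u) + d(u')) + 8 * n + 2 * dist(u, u') + 4`, where `d(u)` is the sum of the
distances from `u` (`wiener_extend`).

The model is balanced: whatever `q` is, the laws of `u` and `u'` add up to `1 / n` times the counting
measure on the nodes of `T_n` (`sum_integral_pick`). Hence `d(u) + d(u')` has conditional mean
`W_n / n`, and `W_n / (n * (n + 1))`, centred by a deterministic sequence, changes in one step by a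
centred term of order `(d(u) + d(u')) / n ^ 2` and by a term of order `dist(u, u') / n ^ 2`
(`rescaled_extend`).

Both terms are controlled by depths, through the triangle inequality. The balance property also
makes `E ∑ v, (3 / 2) ^ depth v` satisfy an exact recursion, so it is `O(n ^ (3 / 2))`
(`integral_depthExp_le`), and so is the mean sum of the squared depths. It follows that the second
moments of the rescaled sequence obey `B_{n+1} + C ≤ (1 + n ^ (-3 / 2)) * (B_n + C)`
(`integral_rescaled_sq_succ_le`). As `n ^ (-3 / 2)` is summable they are bounded, and undoing the
scaling gives `Var S_n = O(n ^ 4)`.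
-/

namespace BCMRT


/-! ### Separation counts and the edge sum of a tree -/

open Classical in
/-- The number of edges of `G` whose removal separates `a` from `b`. In a tree this is the distance
between `a` and `b`. -/
noncomputable def sep {V : Type*} [Fintype V] (G : SimpleGraph V) (a b : V) : ℕ :=
  (G.edgeFinset.filter fun e => ¬ (G.deleteEdges {e}).Reachable a b).card

section Sep

variable {V : Type*} [Fintype V] (G : SimpleGraph V)

lemma sep_self (a : V) : sep G a a = 0 := by
  simp [sep]

lemma sep_comm (a b : V) : sep G a b = sep G b a := by
  unfold sep
  congr 1
  ext e
  simp only [Finset.mem_filter]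
  rw [SimpleGraph.reachable_comm]

lemma sep_triangle (a b c : V) : sep G a c ≤ sep G a b + sep G b c := by
  classical
  unfold sep
  refine le_trans (Finset.card_le_card ?_) (Finset.card_union_le _ _)
  intro e he
  simp only [Finset.mem_union, Finset.mem_filter] at he ⊢
  by_contra! h
  exact he.2 ((h.1 he.1).trans (h.2 he.1))

end Sep

/-- Each node in the component of `x` stays connected to `x` or to `y` when `s(x, y)` is removed. -/
lemma reachable_or_of_deleteEdges {V : Type*} {G : SimpleGraph V} {x y w : V}
    (h : G.Reachable x w) :
    (G.deleteEdges {s(x, y)}).Reachable x w ∨ (G.deleteEdges {s(x, y)}).Reachable y w := by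
  rw [SimpleGraph.reachable_iff_reflTransGen] at h
  induction h with
  | refl => exact Or.inl (SimpleGraph.Reachable.refl _)
  | @tail b c _ hbc ih =>
    by_cases he : s(b, c) = s(x, y)
    · rw [Sym2.eq_iff] at he
      rcases he with ⟨-, rfl⟩ | ⟨-, rfl⟩
      · exact Or.inr (SimpleGraph.Reachable.refl _)
      · exact Or.inl (SimpleGraph.Reachable.refl _)
    · have hadj : (G.deleteEdges {s(x, y)}).Adj b c := by
        simp [SimpleGraph.deleteEdges_adj, hbc, he]
      exact ih.imp (fun h => h.trans hadj.reachable) (fun h => h.trans hadj.reachable)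

open Classical in
/-- An edge of a tree separates exactly the ordered pairs with one node on each of its sides, so
the product of the two side sizes counts every separated pair twice. -/
lemma two_mul_edgeProduct {V : Type*} [Fintype V] {G : SimpleGraph V} (hG : G.IsTree)
    {e : Sym2 V} (he : e ∈ G.edgeSet) :
    2 * edgeProduct G e =
      (Finset.univ.filter fun p : V × V => ¬ (G.deleteEdges {e}).Reachable p.1 p.2).card := by
  induction e with
  | h x y =>
    have hbr := SimpleGraph.isAcyclic_iff_forall_isBridge.mp hG.isAcyclic he
    rw [SimpleGraph.isBridge_iff] at hbr
    set H := G.deleteEdges {s(x, y)} with hH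
    have hor : ∀ w, H.Reachable x w ∨ H.Reachable y w := fun w =>
      reachable_or_of_deleteEdges (hG.connected x w)
    set X : Finset V := Finset.univ.filter fun w => H.Reachable x w with hX
    set Y : Finset V := Finset.univ.filter fun w => H.Reachable y w with hY
    have hXc : sideSize G s(x, y) x = X.card := by
      rw [sideSize, Set.ncard_eq_toFinset_card']
      congr 1
      ext w
      simp [hX, hH]
    have hYc : sideSize G s(x, y) y = Y.card := by
      rw [sideSize, Set.ncard_eq_toFinset_card']
      congr 1
      ext w
      simp [hY, hH]
    have hunion : (Finset.univ.filter fun p : V × V => ¬ H.Reachable p.1 p.2)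
        = X ×ˢ Y ∪ Y ×ˢ X := by
      ext ⟨a, b⟩
      simp only [Finset.mem_filter, Finset.mem_univ, true_and, Finset.mem_union,
        Finset.mem_product, hX, hY]
      constructor
      · intro h
        rcases hor a with ha | ha <;> rcases hor b with hb | hb
        · exact absurd (ha.symm.trans hb) h
        · exact Or.inl ⟨ha, hb⟩
        · exact Or.inr ⟨ha, hb⟩
        · exact absurd (ha.symm.trans hb) h
      · rintro (⟨ha, hb⟩ | ⟨ha, hb⟩) h
        · exact hbr ((ha.trans h).trans hb.symm)
        · exact hbr ((hb.trans h.symm).trans ha.symm)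
    have hdisj : Disjoint (X ×ˢ Y) (Y ×ˢ X) := by
      rw [Finset.disjoint_left]
      rintro ⟨a, b⟩ h1 h2
      simp only [Finset.mem_product, hX, hY, Finset.mem_filter, Finset.mem_univ, true_and] at h1 h2
      exact hbr (h1.1.trans h2.1.symm)
    rw [hunion, Finset.card_union_of_disjoint hdisj, Finset.card_product, Finset.card_product]
    simp only [edgeProduct, Sym2.lift_mk, hXc, hYc]
    ring

/-- Double counting of the pairs (edge, ordered pair of nodes that it separates). -/
lemma two_mul_edgeSum {V : Type*} [Fintype V] {G : SimpleGraph V} (hG : G.IsTree) :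
    2 * edgeSum G = ∑ a, ∑ b, sep G a b := by
  classical
  rw [← Fintype.sum_prod_type', edgeSum, Finset.mul_sum]
  simp only [sep, Finset.card_filter]
  rw [Finset.sum_comm]
  refine Finset.sum_congr (by ext; simp) fun e he => ?_
  rw [two_mul_edgeProduct hG (by simpa using he), Finset.card_filter]

/-! ### Attaching leaves to a tree -/

/-- `G'` arises from `G`, embedded by `f`, by attaching leaves: every node `x` of `G'` outside the
range of `f` has `f (r x)` as its only neighbour, and `r` is a retraction of `f`. -/
structure IsLeafExtension {V V' : Type*} (G : SimpleGraph V) (G' : SimpleGraph V') (f : V → V')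
    (r : V' → V) : Prop where
  retract : ∀ a, r (f a) = a
  adj_iff : ∀ a b, G'.Adj (f a) (f b) ↔ G.Adj a b
  adj_new : ∀ x, x ∉ Set.range f → ∀ y, G'.Adj x y ↔ y = f (r x)

namespace IsLeafExtension

variable {V V' : Type*} {G : SimpleGraph V} {G' : SimpleGraph V'} {f : V → V'} {r : V' → V}

lemma injective (h : IsLeafExtension G G' f r) : Function.Injective f :=
  Function.LeftInverse.injective h.retract

lemma reachable_map (h : IsLeafExtension G G' f r) {a b : V} (hab : G.Reachable a b) :
    G'.Reachable (f a) (f b) :=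
  hab.map ⟨f, fun {a b} hh => (h.adj_iff a b).2 hh⟩

lemma eq_or_adj_retract (h : IsLeafExtension G G' f r) (x : V') :
    x = f (r x) ∨ G'.Adj x (f (r x)) := by
  by_cases hx : x ∈ Set.range f
  · obtain ⟨a, rfl⟩ := hx
    left; rw [h.retract]
  · exact Or.inr ((h.adj_new x hx _).2 rfl)

/-- An edge of the extension is collapsed by the retraction or comes from an edge of `G`. -/
lemma retract_adj (h : IsLeafExtension G G' f r) {x y : V'} (hxy : G'.Adj x y) :
    r x = r y ∨ G.Adj (r x) (r y) := by
  by_cases hx : x ∈ Set.range f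
  · by_cases hy : y ∈ Set.range f
    · obtain ⟨a, rfl⟩ := hx
      obtain ⟨b, rfl⟩ := hy
      right
      rw [h.retract, h.retract]
      exact (h.adj_iff a b).1 hxy
    · left
      rw [(h.adj_new y hy x).1 hxy.symm, h.retract]
  · left
    rw [(h.adj_new x hx y).1 hxy, h.retract]

lemma reachable_iff (h : IsLeafExtension G G' f r) (x y : V') :
    G'.Reachable x y ↔ G.Reachable (r x) (r y) := by
  have hr : ∀ z, G'.Reachable z (f (r z)) := fun z => by
    rcases h.eq_or_adj_retract z with hz | hz
    · rw [← hz]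
    · exact hz.reachable
  constructor
  · intro hxy
    rw [SimpleGraph.reachable_iff_reflTransGen] at hxy
    induction hxy with
    | refl => exact SimpleGraph.Reachable.refl _
    | tail _ hbc ih =>
      rcases h.retract_adj hbc with hh | hh
      · rwa [← hh]
      · exact ih.trans hh.reachable
  · intro hxy
    exact ((hr x).trans (h.reachable_map hxy)).trans (hr y).symm

lemma deleteEdges (h : IsLeafExtension G G' f r) (e : Sym2 V) :
    IsLeafExtension (G.deleteEdges {e}) (G'.deleteEdges {e.map f}) f r where
  retract := h.retract
  adj_iff a b := by
    simp only [SimpleGraph.deleteEdges_adj, h.adj_iff, Set.mem_singleton_iff, ← Sym2.map_mk,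
      (Sym2.map.injective h.injective).eq_iff]
  adj_new x hx y := by
    rw [SimpleGraph.deleteEdges_adj, h.adj_new x hx y, and_iff_left_iff_imp]
    rintro - he
    have : x ∈ e.map f := by rw [← Set.mem_singleton_iff.1 he]; simp
    rw [Sym2.mem_map] at this
    obtain ⟨a, -, rfl⟩ := this
    exact hx ⟨a, rfl⟩

/-- Removing the edge at a new leaf isolates this leaf and nothing else. -/
lemma reachable_deleteEdges_leaf (h : IsLeafExtension G G' f r) (hG : G.Connected) {x : V'}
    (hx : x ∉ Set.range f) (a b : V') :
    (G'.deleteEdges {s(x, f (r x))}).Reachable a b ↔ (a = x ↔ b = x) := by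
  have hne : ∀ a, f a ≠ x := fun a ha => hx ⟨a, ha⟩
  constructor
  · intro hab
    rw [SimpleGraph.reachable_iff_reflTransGen] at hab
    induction hab with
    | refl => rfl
    | @tail b c _ hbc ih =>
      rw [ih]
      rw [SimpleGraph.deleteEdges_adj, Set.mem_singleton_iff] at hbc
      constructor
      · rintro rfl
        exact absurd (by rw [(h.adj_new b hx c).1 hbc.1]) hbc.2
      · rintro rfl
        exact absurd (by rw [(h.adj_new c hx b).1 hbc.1.symm, Sym2.eq_swap]) hbc.2
  · intro hab
    by_cases ha : a = x
    · rw [ha, hab.1 ha]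
    · have hb : b ≠ x := fun hb => ha (hab.2 hb)
      have hr : ∀ z, z ≠ x → (G'.deleteEdges {s(x, f (r x))}).Reachable z (f (r z)) := by
        intro z hz
        rcases h.eq_or_adj_retract z with hz' | hz'
        · rw [← hz']
        · refine SimpleGraph.Adj.reachable ?_
          rw [SimpleGraph.deleteEdges_adj, Set.mem_singleton_iff, Sym2.eq_iff]
          refine ⟨hz', ?_⟩
          rintro (⟨h1, -⟩ | ⟨-, h1⟩)
          · exact hz h1
          · exact hne _ h1
      have hf : (G'.deleteEdges {s(x, f (r x))}).Reachable (f (r a)) (f (r b)) := by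
        refine (hG (r a) (r b)).map ⟨f, fun {c d} hcd => ?_⟩
        rw [SimpleGraph.deleteEdges_adj, Set.mem_singleton_iff, Sym2.eq_iff]
        refine ⟨(h.adj_iff c d).2 hcd, ?_⟩
        rintro (⟨h1, -⟩ | ⟨-, h1⟩)
        · exact hne _ h1
        · exact hne _ h1
      exact ((hr a ha).trans hf).trans (hr b hb).symm

lemma mem_edgeSet_iff (h : IsLeafExtension G G' f r) (e : Sym2 V') :
    e ∈ G'.edgeSet ↔
      (∃ e₀ ∈ G.edgeSet, e₀.map f = e) ∨ ∃ x, x ∉ Set.range f ∧ s(x, f (r x)) = e := by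
  constructor
  · induction e with
    | h x y =>
      intro hxy
      rw [SimpleGraph.mem_edgeSet] at hxy
      by_cases hx : x ∈ Set.range f
      · by_cases hy : y ∈ Set.range f
        · obtain ⟨a, rfl⟩ := hx
          obtain ⟨b, rfl⟩ := hy
          exact Or.inl ⟨s(a, b), (h.adj_iff a b).1 hxy, rfl⟩
        · exact Or.inr ⟨y, hy, by rw [← (h.adj_new y hy x).1 hxy.symm, Sym2.eq_swap]⟩
      · exact Or.inr ⟨x, hx, by rw [← (h.adj_new x hx y).1 hxy]⟩
  · rintro (⟨e₀, he₀, rfl⟩ | ⟨x, hx, rfl⟩)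
    · induction e₀ with
      | h a b => exact (h.adj_iff a b).2 he₀
    · exact (h.adj_new x hx _).2 rfl

lemma isTree (h : IsLeafExtension G G' f r) (hG : G.IsTree) : G'.IsTree := by
  have : Nonempty V' := hG.connected.nonempty.map f
  refine ⟨⟨fun x y => (h.reachable_iff x y).2 (hG.connected _ _)⟩, ?_⟩
  rw [SimpleGraph.isAcyclic_iff_forall_isBridge]
  intro e he
  rcases (h.mem_edgeSet_iff e).1 he with ⟨e₀, he₀, rfl⟩ | ⟨x, hx, rfl⟩
  · have hb := SimpleGraph.isAcyclic_iff_forall_isBridge.mp hG.isAcyclic he₀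
    induction e₀ with
    | h a b =>
      have hd := (h.deleteEdges s(a, b)).reachable_iff (f a) (f b)
      rw [h.retract, h.retract] at hd
      rw [SimpleGraph.isBridge_iff] at hb
      rw [Sym2.map_mk, SimpleGraph.isBridge_iff, ← Sym2.map_mk, hd]
      exact hb
  · rw [SimpleGraph.isBridge_iff, h.reachable_deleteEdges_leaf hG.connected hx]
    intro hh
    exact hx ⟨_, hh.1 rfl⟩

variable [Fintype V] [Fintype V']

open Classical in
/-- The old edges contribute the separation count of the retracted nodes, and the edge at a new
leaf separates exactly the pairs that contain this leaf once. -/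
lemma sep_eq (h : IsLeafExtension G G' f r) (hG : G.Connected) (a b : V') :
    sep G' a b = sep G (r a) (r b) +
      (Finset.univ.filter fun x => x ∉ Set.range f ∧ ¬ (a = x ↔ b = x)).card := by
  have hinj : Function.Injective (Sym2.map f) := Sym2.map.injective h.injective
  have hset : (G'.edgeFinset.filter fun e => ¬ (G'.deleteEdges {e}).Reachable a b) =
      ((G.edgeFinset.filter fun e => ¬ (G.deleteEdges {e}).Reachable (r a) (r b)).image
        (Sym2.map f)) ∪
      (Finset.univ.filter fun x => x ∉ Set.range f ∧ ¬ (a = x ↔ b = x)).image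
        (fun x => s(x, f (r x))) := by
    ext e
    simp only [Finset.mem_filter, SimpleGraph.mem_edgeFinset, Finset.mem_union, Finset.mem_image,
      Finset.mem_univ, true_and]
    rw [h.mem_edgeSet_iff]
    constructor
    · rintro ⟨⟨e₀, he₀, rfl⟩ | ⟨x, hx, rfl⟩, hr⟩
      · exact Or.inl ⟨e₀, ⟨he₀, fun hh => hr (((h.deleteEdges e₀).reachable_iff a b).2 hh)⟩, rfl⟩
      · exact Or.inr ⟨x, ⟨hx, fun hh => hr ((h.reachable_deleteEdges_leaf hG hx a b).2 hh)⟩, rfl⟩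
    · rintro (⟨e₀, ⟨he₀, hr⟩, rfl⟩ | ⟨x, ⟨hx, hr⟩, rfl⟩)
      · exact ⟨Or.inl ⟨e₀, he₀, rfl⟩, fun hh => hr (((h.deleteEdges e₀).reachable_iff a b).1 hh)⟩
      · exact ⟨Or.inr ⟨x, hx, rfl⟩, fun hh => hr ((h.reachable_deleteEdges_leaf hG hx a b).1 hh)⟩
  have hdisj : Disjoint
      ((G.edgeFinset.filter fun e => ¬ (G.deleteEdges {e}).Reachable (r a) (r b)).image
        (Sym2.map f))
      ((Finset.univ.filter fun x => x ∉ Set.range f ∧ ¬ (a = x ↔ b = x)).image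
        (fun x => s(x, f (r x)))) := by
    rw [Finset.disjoint_left]
    intro e h1 h2
    simp only [Finset.mem_image, Finset.mem_filter, Finset.mem_univ, true_and] at h1 h2
    obtain ⟨e₀, -, rfl⟩ := h1
    obtain ⟨x, ⟨hx, -⟩, he⟩ := h2
    have : x ∈ e₀.map f := by rw [← he]; simp
    rw [Sym2.mem_map] at this
    obtain ⟨c, -, rfl⟩ := this
    exact hx ⟨c, rfl⟩
  have hinj' : Set.InjOn (fun x => s(x, f (r x)))
      ((Finset.univ.filter fun x => x ∉ Set.range f ∧ ¬ (a = x ↔ b = x) : Finset V') : Set V') := by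
    intro x hx y hy hxy
    simp only [Finset.coe_filter, Finset.mem_univ, true_and, Set.mem_ofPred_eq] at hx hy
    rcases Sym2.eq_iff.1 hxy with ⟨h1, -⟩ | ⟨h1, -⟩
    · exact h1
    · exact absurd ⟨_, h1.symm⟩ hx.1
  rw [sep, sep, hset, Finset.card_union_of_disjoint hdisj, Finset.card_image_of_injective _ hinj,
    Finset.card_image_of_injOn hinj']

lemma sep_old_old (h : IsLeafExtension G G' f r) (hG : G.Connected) (a b : V) :
    sep G' (f a) (f b) = sep G a b := by
  classical
  rw [h.sep_eq hG, h.retract, h.retract, add_eq_left, Finset.card_eq_zero,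
    Finset.filter_eq_empty_iff]
  rintro x - ⟨hx, hh⟩
  refine hh ⟨?_, ?_⟩ <;> rintro rfl <;> exact absurd ⟨_, rfl⟩ hx

lemma sep_new_old (h : IsLeafExtension G G' f r) (hG : G.Connected) {x : V'}
    (hx : x ∉ Set.range f) (b : V) :
    sep G' x (f b) = sep G (r x) b + 1 := by
  classical
  rw [h.sep_eq hG, h.retract, add_right_inj, Finset.card_eq_one]
  refine ⟨x, ?_⟩
  ext y
  simp only [Finset.mem_filter, Finset.mem_univ, true_and, Finset.mem_singleton]
  constructor
  · rintro ⟨hy, hh⟩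
    by_contra hne
    refine hh ⟨fun h1 => absurd h1.symm hne, fun h1 => absurd ⟨b, h1⟩ hy⟩
  · rintro rfl
    exact ⟨hx, fun hh => hx ⟨b, hh.1 rfl⟩⟩

lemma sep_new_new (h : IsLeafExtension G G' f r) (hG : G.Connected) {x y : V'}
    (hx : x ∉ Set.range f) (hy : y ∉ Set.range f) (hxy : x ≠ y) :
    sep G' x y = sep G (r x) (r y) + 2 := by
  classical
  rw [h.sep_eq hG, add_right_inj, Finset.card_eq_two]
  refine ⟨x, y, hxy, ?_⟩
  ext z
  simp only [Finset.mem_filter, Finset.mem_univ, true_and, Finset.mem_singleton,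
    Finset.mem_insert]
  constructor
  · rintro ⟨-, hh⟩
    by_contra hne
    push Not at hne
    exact hh ⟨fun h1 => absurd h1.symm hne.1, fun h1 => absurd h1.symm hne.2⟩
  · rintro (rfl | rfl)
    · exact ⟨hx, fun hh => hxy (hh.1 rfl).symm⟩
    · exact ⟨hy, fun hh => hxy (hh.2 rfl)⟩

end IsLeafExtension


/-! ### One growth step of the tree -/

/-- The inclusion of the nodes of `T_n` among the nodes of `T_{n+1}`. -/
def embed {n : ℕ} (v : Node n) : Node (n + 1) := (v.1.castSucc, v.2)

/-- The choices of the two nodes with time-label `n + 1`, one for each type. -/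
abbrev StepChoices (n : ℕ) : Type := Bool → Bool × Fin n

/-- The choices for `T_{n+1}` obtained from those for `T_n` and those of the two new nodes. -/
def extend {n : ℕ} (ω : Choices n) (c : StepChoices n) : Choices (n + 1) := fun v =>
  if h : v.1.1.val < n then ω ⟨(⟨v.1.1.val, h⟩, v.1.2), v.2⟩
  else ((c v.1.2).1, Fin.cast (by have := v.1.1.isLt; omega) (c v.1.2).2)

/-- The node that a new node of type `Λ` making the choice `d` attaches to. -/
def pick {n : ℕ} (Λ : Bool) (d : Bool × Fin n) : Node n := (d.2, xor Λ d.1)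

/-- The retraction of the nodes of `T_{n+1}` onto those of `T_n` sending each new node to its
parent. -/
def retraction {n : ℕ} (c : StepChoices n) (v : Node (n + 1)) : Node n :=
  if h : v.1.val < n then (⟨v.1.val, h⟩, v.2) else pick v.2 (c v.2)

lemma embed_injective {n : ℕ} : Function.Injective (embed (n := n)) := by
  rintro ⟨a, x⟩ ⟨b, y⟩ h
  simpa [embed] using h

lemma notMem_range_embed {n : ℕ} {v : Node (n + 1)} :
    v ∉ Set.range embed ↔ v.1 = Fin.last n := by
  constructor
  · intro h
    by_contra hne
    refine h ⟨(v.1.castPred hne, v.2), ?_⟩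
    simp [embed]
  · rintro h ⟨w, rfl⟩
    simp [embed] at h

lemma retraction_last {n : ℕ} (c : StepChoices n) (Λ : Bool) :
    retraction c (Fin.last n, Λ) = pick Λ (c Λ) := by
  simp [retraction]

lemma sum_node_succ {M : Type*} [AddCommMonoid M] {n : ℕ} (g : Node (n + 1) → M) :
    ∑ v, g v = ∑ v : Node n, g (embed v) + ∑ Λ : Bool, g (Fin.last n, Λ) := by
  rw [Fintype.sum_prod_type, Fin.sum_univ_castSucc, Fintype.sum_prod_type]
  rfl

lemma tree_adj {n : ℕ} (ω : Choices n) (x y : Node n) :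
    (tree ω).Adj x y ↔ x ≠ y ∧ ((x.1.val = 0 ∧ y.1.val = 0) ∨
      (∃ h : 0 < x.1.val, y = parent ω ⟨x, h⟩) ∨ ∃ h : 0 < y.1.val, x = parent ω ⟨y, h⟩) := by
  rw [tree, SimpleGraph.fromRel_adj]
  tauto

lemma parent_extend_embed {n : ℕ} (ω : Choices n) (c : StepChoices n) (v : Node n)
    (h : 0 < v.1.val) :
    parent (extend ω c) ⟨embed v, h⟩ = embed (parent ω ⟨v, h⟩) := by
  have : (embed v).1.val < n := v.1.isLt
  ext <;> simp [parent, extend, embed]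

lemma parent_extend_last {n : ℕ} (ω : Choices n) (c : StepChoices n) (Λ : Bool)
    (h : 0 < (Fin.last n).val) :
    parent (extend ω c) ⟨(Fin.last n, Λ), h⟩ = embed (pick Λ (c Λ)) := by
  ext <;> simp [parent, extend, embed, pick]

lemma parent_lt {n : ℕ} (ω : Choices n) (v : NonRoot n) : (parent ω v).1 < v.1.1 :=
  (ω v).2.isLt

/-- A growth step attaches the two new nodes as leaves. -/
lemma isLeafExtension_extend {n : ℕ} (hn : 0 < n) (ω : Choices n) (c : StepChoices n) :
    IsLeafExtension (tree ω) (tree (extend ω c)) embed (retraction c) where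
  retract a := by simp [retraction, embed]
  adj_iff a b := by
    rw [tree_adj, tree_adj, embed_injective.ne_iff]
    have h0 : ∀ a : Node n, (embed a).1.val = a.1.val := fun _ => rfl
    have hp : ∀ a b : Node n, (∃ h : 0 < (embed a).1.val,
        embed b = parent (extend ω c) ⟨embed a, h⟩) ↔
        ∃ h : 0 < a.1.val, b = parent ω ⟨a, h⟩ := fun a b =>
      ⟨fun ⟨h, e⟩ => ⟨h, embed_injective (e.trans (parent_extend_embed ω c a h))⟩,
        fun ⟨h, e⟩ => ⟨h, (congrArg embed e).trans (parent_extend_embed ω c a h).symm⟩⟩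
    rw [hp, hp, h0, h0]
  adj_new x hx y := by
    obtain ⟨k, Λ⟩ := x
    rw [notMem_range_embed] at hx
    obtain rfl : k = Fin.last n := hx
    rw [tree_adj, retraction_last]
    have hp := parent_extend_last ω c Λ hn
    constructor
    · rintro ⟨-, ⟨h, -⟩ | ⟨h, rfl⟩ | ⟨h, hy⟩⟩
      · simp at h; omega
      · exact hp
      · have := parent_lt (extend ω c) ⟨y, h⟩
        rw [← hy] at this
        exact absurd (Fin.le_last y.1) (not_le.2 this)
    · rintro rfl
      refine ⟨fun hh => ?_, Or.inr (Or.inl ⟨hn, hp.symm⟩)⟩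
      have hl : (Fin.last n, Λ).1 = Fin.last n := rfl
      rw [hh] at hl
      exact (Fin.castSucc_lt_last _).ne hl

/-- The first tree is a leaf attached to a single node. -/
lemma isLeafExtension_one (ω : Choices 1) :
    IsLeafExtension (⊥ : SimpleGraph Unit) (tree ω) (fun _ => (0, false)) (fun _ => ()) where
  retract _ := rfl
  adj_iff a b := by simp
  adj_new x hx y := by
    have h1 : ∀ z : Node 1, z = (0, z.2) := fun z => Prod.ext (Subsingleton.elim _ _) rfl
    have hx' : x = (0, true) := by
      rw [h1 x]
      rcases hb : x.2 with - | -
      · exact absurd ⟨(), by rw [h1 x, hb]⟩ hx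
      · rfl
    subst hx'
    rw [tree_adj, h1 y]
    rcases y.2 <;> simp

lemma isTree_unit : (⊥ : SimpleGraph Unit).IsTree :=
  SimpleGraph.IsTree.of_subsingleton

/-- The choices of the nodes of `T_n` among those of the nodes of `T_{n+1}`. -/
def restrict {n : ℕ} (ω : Choices (n + 1)) : Choices n := fun v => ω ⟨embed v.1, v.2⟩

/-- The choices of the two newest nodes of `T_{n+1}`. -/
def lastChoices {n : ℕ} (hn : 0 < n) (ω : Choices (n + 1)) : StepChoices n :=
  fun Λ => ω ⟨(Fin.last n, Λ), hn⟩

lemma restrict_extend {n : ℕ} (ω : Choices n) (c : StepChoices n) :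
    restrict (extend ω c) = ω := by
  funext v
  have : (embed v.1).1.val < n := v.1.1.isLt
  simp [restrict, extend, embed]

lemma lastChoices_extend {n : ℕ} (hn : 0 < n) (ω : Choices n) (c : StepChoices n) :
    lastChoices hn (extend ω c) = c := by
  funext Λ
  simp [lastChoices, extend]

lemma extend_restrict {n : ℕ} (hn : 0 < n) (ω : Choices (n + 1)) :
    extend (restrict ω) (lastChoices hn ω) = ω := by
  funext ⟨⟨k, Λ⟩, hv⟩
  by_cases h : k.val < n
  · simp only [extend, h, dite_true]
    rfl
  · obtain rfl : k = Fin.last n := by ext; have := k.isLt; simp; omega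
    simp only [extend, h, dite_false]
    rfl

lemma isTree_tree : ∀ {n : ℕ} (_ : 0 < n) (ω : Choices n), (tree ω).IsTree
  | 1, _, ω => (isLeafExtension_one ω).isTree isTree_unit
  | n + 2, _, ω => by
    have h := isLeafExtension_extend n.succ_pos (restrict ω) (lastChoices n.succ_pos ω)
    rw [extend_restrict] at h
    exact h.isTree (isTree_tree n.succ_pos _)

/-! ### The law of one growth step -/

instance nonempty_fin_nonRoot {n : ℕ} (v : NonRoot n) : Nonempty (Fin v.1.1.val) := ⟨⟨0, v.2⟩⟩

instance isProbabilityMeasure_law (q : unitInterval) (n : ℕ) : IsProbabilityMeasure (law q n) := by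
  unfold law; infer_instance

/-- The law of the choice of one node of `T_{n+1}` with the largest time-label. -/
noncomputable def choiceLaw (q : unitInterval) (n : ℕ) : Measure (Bool × Fin n) :=
  (bernoulliMeasure true false q).prod (uniformOn Set.univ)

/-- The joint law of the choices of the two nodes of `T_{n+1}` with the largest time-label. -/
noncomputable def stepLaw (q : unitInterval) (n : ℕ) : Measure (StepChoices n) :=
  Measure.pi fun _ => choiceLaw q n

instance isProbabilityMeasure_choiceLaw (q : unitInterval) (n : ℕ) [NeZero n] :
    IsProbabilityMeasure (choiceLaw q n) := by
  unfold choiceLaw; infer_instance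

instance isProbabilityMeasure_stepLaw (q : unitInterval) (n : ℕ) [NeZero n] :
    IsProbabilityMeasure (stepLaw q n) := by
  unfold stepLaw; infer_instance

/-- The non-root nodes of `T_{n+1}` are those of `T_n` and the two newest nodes. -/
def nonRootEquiv {n : ℕ} (hn : 0 < n) : NonRoot n ⊕ Bool ≃ NonRoot (n + 1) where
  toFun := Sum.elim (fun v => ⟨embed v.1, v.2⟩) (fun Λ => ⟨(Fin.last n, Λ), hn⟩)
  invFun v := if h : v.1.1.val < n then Sum.inl ⟨(⟨v.1.1.val, h⟩, v.1.2), v.2⟩ else Sum.inr v.1.2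
  left_inv := by
    rintro (⟨v, hv⟩ | Λ)
    · simp [embed]
    · simp
  right_inv := by
    rintro ⟨⟨k, Λ⟩, hv⟩
    by_cases h : k.val < n
    · simp [h, embed]
    · obtain rfl : k = Fin.last n := by ext; have := k.isLt; simp; omega
      simp

/-- Conditionally on `T_n`, the choices of the two new nodes are independent and distributed
according to `choiceLaw`. -/
lemma map_extend (q : unitInterval) (n : ℕ) [NeZero n] :
    ((law q n).prod (stepLaw q n)).map (fun p => extend p.1 p.2) = law q (n + 1) := by
  have hn : 0 < n := NeZero.pos n
  refine Measure.ext_of_singleton fun ω => ?_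
  rw [Measure.map_apply (measurable_of_finite _) (measurableSet_singleton _)]
  have hpre : (fun p : Choices n × StepChoices n => extend p.1 p.2) ⁻¹' {ω} =
      {restrict ω} ×ˢ {lastChoices hn ω} := by
    ext ⟨ω₀, c⟩
    simp only [Set.mem_preimage, Set.mem_singleton_iff, Set.mem_prod]
    constructor
    · rintro rfl
      exact ⟨(restrict_extend _ _).symm, (lastChoices_extend hn _ _).symm⟩
    · rintro ⟨rfl, rfl⟩
      exact extend_restrict hn ω
  rw [hpre, Measure.prod_prod, law, law, stepLaw, Measure.pi_singleton, Measure.pi_singleton,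
    Measure.pi_singleton, ← (nonRootEquiv hn).prod_comp, Fintype.prod_sum_type]
  rfl

lemma integral_law_succ (q : unitInterval) (n : ℕ) [NeZero n] (F : Choices (n + 1) → ℝ) :
    ∫ ω, F ω ∂law q (n + 1) = ∫ ω, ∫ c, F (extend ω c) ∂stepLaw q n ∂law q n := by
  rw [← map_extend, integral_map (measurable_of_finite _).aemeasurable
    .of_discrete, integral_prod _ .of_finite]

lemma integral_choiceLaw (q : unitInterval) (n : ℕ) [NeZero n] (g : Bool × Fin n → ℝ) :
    ∫ d, g d ∂choiceLaw q n =
      (∑ k, ((q : ℝ) * g (true, k) + (1 - q) * g (false, k))) / n := by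
  have hu : ∀ h : Fin n → ℝ, ∫ k, h k ∂(uniformOn Set.univ : Measure (Fin n)) = (∑ k, h k) / n := by
    intro h
    rw [integral_fintype .of_finite, Finset.sum_div]
    refine Finset.sum_congr rfl fun k _ => ?_
    simp [measureReal_def, uniformOn_univ, div_eq_inv_mul]
  rw [choiceLaw, integral_prod _ .of_finite, integral_bernoulliMeasure, hu, hu,
    Finset.sum_add_distrib, ← Finset.mul_sum, ← Finset.mul_sum]
  simp only [smul_eq_mul]
  ring

/-- The balance property: summed over the two new nodes, the law of the parent is `1 / n` times the
counting measure on the nodes of `T_n`, whatever the value of `q`. -/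
lemma sum_integral_pick (q : unitInterval) (n : ℕ) [NeZero n] (g : Node n → ℝ) :
    ∑ Λ, ∫ c, g (pick Λ (c Λ)) ∂stepLaw q n = (∑ v, g v) / n := by
  have h : ∀ Λ : Bool, ∫ c, g (pick Λ (c Λ)) ∂stepLaw q n =
      ∫ d, g (pick Λ d) ∂choiceLaw q n := fun Λ =>
    integral_comp_eval (μ := fun _ : Bool => choiceLaw q n) (f := fun d => g (pick Λ d))
      .of_discrete
  rw [Finset.sum_congr rfl fun Λ _ => h Λ]
  simp only [integral_choiceLaw]
  rw [Fintype.sum_bool, Fintype.sum_prod_type, ← add_div, ← Finset.sum_add_distrib]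
  congr 1
  refine Finset.sum_congr rfl fun k _ => ?_
  simp [pick]
  ring


/-! ### Depths and total distances along one growth step -/

/-- The depth of a node, that is, its distance to the node `(1, A)`. -/
noncomputable def depth {n : ℕ} [NeZero n] (ω : Choices n) (v : Node n) : ℕ :=
  sep (tree ω) v (0, false)

/-- The sum of the distances from `u` to all nodes. -/
noncomputable def distSum {n : ℕ} (ω : Choices n) (u : Node n) : ℝ :=
  ∑ b, (sep (tree ω) u b : ℝ)

/-- The sum of the squared depths. -/
noncomputable def depthSq {n : ℕ} [NeZero n] (ω : Choices n) : ℝ :=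
  ∑ v, (depth ω v : ℝ) ^ 2

/-- The sum of the distances over all ordered pairs of nodes. -/
noncomputable def wiener {n : ℕ} (ω : Choices n) : ℝ := ∑ a, distSum ω a

lemma distSum_nonneg {n : ℕ} (ω : Choices n) (u : Node n) : 0 ≤ distSum ω u :=
  Finset.sum_nonneg fun _ _ => Nat.cast_nonneg _

section Step

variable {n : ℕ} [NeZero n] (ω : Choices n)

lemma S_eq : S n ω = wiener ω / 2 := by
  have h := two_mul_edgeSum (isTree_tree (NeZero.pos n) ω)
  have h' : (2 : ℝ) * (edgeSum (tree ω) : ℝ) = wiener ω := by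
    simp only [wiener, distSum]
    exact_mod_cast h
  rw [S, ← h']
  ring

lemma depth_extend_embed (c : StepChoices n) (v : Node n) :
    depth (extend ω c) (embed v) = depth ω v :=
  (isLeafExtension_extend (NeZero.pos n) ω c).sep_old_old
    (isTree_tree (NeZero.pos n) ω).connected v (0, false)

lemma depth_extend_last (c : StepChoices n) (Λ : Bool) :
    depth (extend ω c) (Fin.last n, Λ) = depth ω (pick Λ (c Λ)) + 1 := by
  rw [← retraction_last]
  exact (isLeafExtension_extend (NeZero.pos n) ω c).sep_new_old
    (isTree_tree (NeZero.pos n) ω).connected (notMem_range_embed.2 rfl) (0, false)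

lemma wiener_extend (c : StepChoices n) :
    wiener (extend ω c) = wiener ω + 2 * ∑ Λ, distSum ω (pick Λ (c Λ)) + 8 * n +
      (2 * sep (tree ω) (pick true (c true)) (pick false (c false)) + 4) := by
  have hL := isLeafExtension_extend (NeZero.pos n) ω c
  have hG := (isTree_tree (NeZero.pos n) ω).connected
  have hold : ∀ a, ∑ b, (sep (tree (extend ω c)) (embed a) (embed b) : ℝ) = distSum ω a :=
    fun a => Finset.sum_congr rfl fun b _ => by rw [hL.sep_old_old hG]
  have hno : ∀ Λ b, sep (tree (extend ω c)) (Fin.last n, Λ) (embed b) =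
      sep (tree ω) (pick Λ (c Λ)) b + 1 := fun Λ b => by
    rw [hL.sep_new_old hG (notMem_range_embed.2 rfl), retraction_last]
  have hon : ∀ Λ b, sep (tree (extend ω c)) (embed b) (Fin.last n, Λ) =
      sep (tree ω) (pick Λ (c Λ)) b + 1 := fun Λ b => by rw [sep_comm, hno]
  have hnn : sep (tree (extend ω c)) (Fin.last n, true) (Fin.last n, false) =
      sep (tree ω) (pick true (c true)) (pick false (c false)) + 2 := by
    rw [hL.sep_new_new hG (notMem_range_embed.2 rfl) (notMem_range_embed.2 rfl) (by simp),
      retraction_last, retraction_last]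
  have hcard : ((Finset.univ : Finset (Node n)).card : ℝ) = 2 * n := by
    simp [mul_comm]
  have hsum : ∀ Λ, ∑ b, ((sep (tree ω) (pick Λ (c Λ)) b + 1 : ℕ) : ℝ) =
      distSum ω (pick Λ (c Λ)) + 2 * n := fun Λ => by
    simp only [Nat.cast_add, Nat.cast_one, Finset.sum_add_distrib, distSum, Finset.sum_const,
      nsmul_eq_mul, mul_one, hcard]
  simp only [wiener]
  rw [sum_node_succ]
  simp only [distSum]
  simp only [sum_node_succ, Finset.sum_add_distrib, Fintype.sum_bool, hold, hno, hon, hsum,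
    sep_self, hnn]
  rw [sep_comm _ (Fin.last n, false), hnn]
  push_cast
  simp only [distSum]
  ring

lemma sep_le_depth (a b : Node n) :
    (sep (tree ω) a b : ℝ) ≤ depth ω a + depth ω b := by
  have h := sep_triangle (tree ω) a (0, false) b
  rw [sep_comm _ (0, false) b] at h
  exact_mod_cast h

/-- The triangle inequality through the root and the Cauchy-Schwarz inequality bound the total
distances by the depths. -/
lemma sum_distSum_sq_le : ∑ u, distSum ω u ^ 2 ≤ 16 * (n : ℝ) ^ 2 * depthSq ω := by
  have hcard : ((Finset.univ : Finset (Node n)).card : ℝ) = 2 * n := by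
    simp [mul_comm]
  have hcs : (∑ b, (depth ω b : ℝ)) ^ 2 ≤ 2 * n * depthSq ω := by
    rw [← hcard]
    exact sq_sum_le_card_mul_sum_sq
  have h1 : ∀ u, distSum ω u ^ 2 ≤
      2 * ((2 * n) ^ 2 * (depth ω u : ℝ) ^ 2 + 2 * n * depthSq ω) := fun u => by
    have hle : distSum ω u ≤ 2 * n * depth ω u + ∑ b, (depth ω b : ℝ) := by
      refine (Finset.sum_le_sum fun b _ => sep_le_depth ω u b).trans_eq ?_
      rw [Finset.sum_add_distrib, Finset.sum_const, nsmul_eq_mul, hcard]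
    calc distSum ω u ^ 2 ≤ (2 * n * depth ω u + ∑ b, (depth ω b : ℝ)) ^ 2 :=
          pow_le_pow_left₀ (distSum_nonneg ω u) hle 2
      _ ≤ 2 * ((2 * n * depth ω u) ^ 2 + (∑ b, (depth ω b : ℝ)) ^ 2) := add_sq_le
      _ ≤ _ := by rw [mul_pow]; gcongr
  refine (Finset.sum_le_sum fun u _ => h1 u).trans_eq ?_
  rw [← Finset.mul_sum, Finset.sum_add_distrib, ← Finset.mul_sum, Finset.sum_const, nsmul_eq_mul,
    hcard, ← depthSq]
  ring

/-- The fluctuation of the total distance from the two new nodes; it is centred given `T_n`. -/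
noncomputable def noise (c : StepChoices n) : ℝ :=
  ∑ Λ, distSum ω (pick Λ (c Λ)) - wiener ω / n

/-- The part of the increment of `wiener` that involves the distance of the two new nodes. -/
noncomputable def cross (c : StepChoices n) : ℝ :=
  2 * sep (tree ω) (pick true (c true)) (pick false (c false)) + 4

variable (q : unitInterval)

lemma integral_noise : ∫ c, noise ω c ∂stepLaw q n = 0 := by
  simp only [noise]
  rw [integral_sub .of_finite .of_finite, integral_finsetSum _ fun _ _ => .of_finite,
    sum_integral_pick, integral_const]
  simp [wiener]

lemma integral_noise_sq_le :
    ∫ c, noise ω c ^ 2 ∂stepLaw q n ≤ 32 * n * depthSq ω := by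
  have hn : (0 : ℝ) < n := Nat.cast_pos.2 (NeZero.pos n)
  -- The second moment about the mean is at most the second moment about zero.
  have h1 : ∀ c, noise ω c ^ 2 ≤ 2 * ∑ Λ, distSum ω (pick Λ (c Λ)) ^ 2 -
      2 * (wiener ω / n) * noise ω c := fun c => by
    have := add_sq_le (a := distSum ω (pick true (c true)))
      (b := distSum ω (pick false (c false)))
    simp only [noise, Fintype.sum_bool] at this ⊢
    nlinarith [sq_nonneg (wiener ω / n)]
  calc ∫ c, noise ω c ^ 2 ∂stepLaw q n
      ≤ ∫ c, (2 * ∑ Λ, distSum ω (pick Λ (c Λ)) ^ 2 - 2 * (wiener ω / n) * noise ω c)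
          ∂stepLaw q n := integral_mono .of_finite .of_finite h1
    _ = 2 * ((∑ u, distSum ω u ^ 2) / n) := by
        rw [integral_sub .of_finite .of_finite, integral_const_mul, integral_const_mul,
          integral_noise, integral_finsetSum _ fun _ _ => .of_finite,
          sum_integral_pick q n fun u => distSum ω u ^ 2]
        ring
    _ ≤ 2 * ((16 * (n : ℝ) ^ 2 * depthSq ω) / n) := by
        gcongr
        exact sum_distSum_sq_le ω
    _ = 32 * n * depthSq ω := by field_simp; ring

lemma integral_cross_sq_le :
    ∫ c, cross ω c ^ 2 ∂stepLaw q n ≤ 16 * depthSq ω / n + 32 := by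
  have h1 : ∀ c, cross ω c ^ 2 ≤ 16 * ∑ Λ, (depth ω (pick Λ (c Λ)) : ℝ) ^ 2 + 32 := fun c => by
    have h2 := sep_le_depth ω (pick true (c true)) (pick false (c false))
    have h0 : (0 : ℝ) ≤ sep (tree ω) (pick true (c true)) (pick false (c false)) :=
      Nat.cast_nonneg _
    simp only [cross, Fintype.sum_bool]
    set s : ℝ := (sep (tree ω) (pick true (c true)) (pick false (c false)) : ℝ)
    set x : ℝ := (depth ω (pick true (c true)) : ℝ)
    set y : ℝ := (depth ω (pick false (c false)) : ℝ)
    have h3 : s ^ 2 ≤ (x + y) ^ 2 := pow_le_pow_left₀ h0 h2 2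
    nlinarith [sq_nonneg (x - y), sq_nonneg (s - 2)]
  refine (integral_mono .of_finite .of_finite h1).trans_eq ?_
  rw [integral_add .of_finite .of_finite, integral_const_mul,
    integral_finsetSum _ fun _ _ => .of_finite,
    sum_integral_pick q n fun u => (depth ω u : ℝ) ^ 2, integral_const]
  simp [depthSq, mul_div_assoc]

end Step

/-! ### Moments of the depths -/

/-- The sum of the powers `(3 / 2) ^ depth` over the nodes. Its mean is at most a constant times
`n ^ (3 / 2)`; any base strictly between `1` and `2` keeps the noise of a growth step summable. -/
noncomputable def depthExp {n : ℕ} [NeZero n] (ω : Choices n) : ℝ :=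
  ∑ v, (3 / 2 : ℝ) ^ depth ω v

lemma integral_depthExp_succ (q : unitInterval) (n : ℕ) [NeZero n] :
    ∫ ω, depthExp ω ∂law q (n + 1) = (1 + 3 / 2 * (1 / n)) * ∫ ω, depthExp ω ∂law q n := by
  rw [integral_law_succ, ← integral_const_mul]
  refine integral_congr_ae (.of_forall fun ω => ?_)
  have h : ∀ c, depthExp (extend ω c) =
      depthExp ω + ∑ Λ, (3 / 2 : ℝ) ^ (depth ω (pick Λ (c Λ)) + 1) := fun c => by
    simp only [depthExp]
    rw [sum_node_succ]
    simp only [depth_extend_embed, depth_extend_last]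
  simp only [h]
  rw [integral_add .of_finite .of_finite, integral_finsetSum _ fun _ _ => .of_finite,
    sum_integral_pick q n fun u => (3 / 2 : ℝ) ^ (depth ω u + 1), integral_const]
  simp only [pow_succ, ← Finset.sum_mul, probReal_univ, one_smul, depthExp]
  ring

lemma depthExp_one (ω : Choices 1) : depthExp ω = 5 / 2 := by
  have hL := isLeafExtension_one ω
  have h0 : depth ω (0, false) = 0 := sep_self _ _
  have h1 : depth ω (0, true) = 1 := by
    have := hL.sep_new_old isTree_unit.connected (x := (0, true)) (by simp) ()
    rwa [sep_self] at this
  simp only [depthExp, Fintype.sum_prod_type, Fin.sum_univ_one, Fintype.sum_bool, h0, h1]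
  norm_num

/-- The factors `1 + (3 / 2) / n` are at most `(1 + 1 / n) ^ (3 / 2)` by Bernoulli's inequality, and
the latter telescope. -/
lemma integral_depthExp_le (q : unitInterval) {n : ℕ} (hn : 1 ≤ n) [NeZero n] :
    ∫ ω, depthExp ω ∂law q n ≤ 5 / 2 * (n : ℝ) ^ (3 / 2 : ℝ) := by
  have key : ∀ m (_ : 1 ≤ m), ∀ [NeZero m],
      ∫ ω, depthExp ω ∂law q m ≤ 5 / 2 * (m : ℝ) ^ (3 / 2 : ℝ) := by
    intro m hm
    induction m, hm using Nat.le_induction with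
    | base => intro _; simp [depthExp_one]
    | succ m hm ih =>
      intro _
      have : NeZero m := ⟨by omega⟩
      have hm0 : (0 : ℝ) < m := by exact_mod_cast hm
      have hB : 1 + 3 / 2 * (1 / (m : ℝ)) ≤ (1 + 1 / (m : ℝ)) ^ (3 / 2 : ℝ) :=
        one_add_mul_self_le_rpow_one_add (by have : 0 < 1 / (m : ℝ) := by positivity
                                             linarith) (by norm_num)
      have h := integral_depthExp_succ q m
      calc ∫ ω, depthExp ω ∂law q (m + 1)
          = (1 + 3 / 2 * (1 / (m : ℝ))) * ∫ ω, depthExp ω ∂law q m := h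
        _ ≤ (1 + 1 / (m : ℝ)) ^ (3 / 2 : ℝ) * (5 / 2 * (m : ℝ) ^ (3 / 2 : ℝ)) := by
            refine mul_le_mul hB ih ?_ (by positivity)
            exact integral_nonneg fun ω => Finset.sum_nonneg fun _ _ => by positivity
        _ = 5 / 2 * ((1 + 1 / (m : ℝ)) * m) ^ (3 / 2 : ℝ) := by
            rw [Real.mul_rpow (by positivity) hm0.le]; ring
        _ = 5 / 2 * ((m + 1 : ℕ) : ℝ) ^ (3 / 2 : ℝ) := by
            congr 2; push_cast; field_simp
  exact key n hn

lemma sq_le_four_mul_pow (d : ℕ) : (d : ℝ) ^ 2 ≤ 4 * (3 / 2) ^ d := by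
  rcases Nat.lt_or_ge d 5 with h | h
  · interval_cases d <;> norm_num
  · induction d, h using Nat.le_induction with
    | base => norm_num
    | succ d hd ih =>
      have hd' : (5 : ℝ) ≤ d := by exact_mod_cast hd
      rw [pow_succ (3 / 2 : ℝ)]
      push_cast
      nlinarith

lemma integral_depthSq_le (q : unitInterval) {n : ℕ} [NeZero n] :
    ∫ ω, depthSq ω ∂law q n ≤ 10 * (n : ℝ) ^ (3 / 2 : ℝ) := by
  have h : ∀ ω : Choices n, depthSq ω ≤ 4 * depthExp ω := fun ω => by
    rw [depthSq, depthExp, Finset.mul_sum]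
    exact Finset.sum_le_sum fun v _ => sq_le_four_mul_pow _
  have h1 := integral_mono (μ := law q n) .of_finite .of_finite h
  rw [integral_const_mul] at h1
  linarith [integral_depthExp_le q (NeZero.one_le (n := n))]

/-! ### The second moment of the rescaled total distance -/

/-- The centring of the rescaled total distance: it accumulates the deterministic increments
`8 * n` of `wiener`, which after rescaling are not summable. -/
noncomputable def centre : ℕ → ℝ
  | 0 => 0
  | n + 1 => centre n + 8 * n / ((n + 1) * (n + 2))

/-- The rescaled and centred total distance. -/
noncomputable def rescaled {n : ℕ} (ω : Choices n) : ℝ :=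
  wiener ω / (n * (n + 1)) - centre n

/-- The normalisation `n * (n + 1)` absorbs the mean growth factor `1 + 2 / n` of `wiener`, so that
the rescaled total distance changes only by a centred term and a small one. -/
lemma rescaled_extend {n : ℕ} [NeZero n] (ω : Choices n) (c : StepChoices n) :
    rescaled (extend ω c) =
      rescaled ω + 2 / ((n + 1) * (n + 2)) * noise ω c + 1 / ((n + 1) * (n + 2)) * cross ω c := by
  have hn : (0 : ℝ) < n := Nat.cast_pos.2 (NeZero.pos n)
  rw [rescaled, wiener_extend, rescaled, noise, cross, centre]
  push_cast
  rw [show (n : ℝ) + 1 + 1 = n + 2 by ring]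
  field_simp
  ring

/-- The second moment of a sum of a constant, a centred variable and a further variable. The
parameter `t` weighs the further variable against the other two. -/
lemma integral_add_sq_le {Ω : Type*} [Finite Ω] [MeasurableSpace Ω] [MeasurableSingletonClass Ω]
    (μ : Measure Ω) [IsProbabilityMeasure μ] (X Z : Ω → ℝ) (hX : ∫ x, X x ∂μ = 0) (y : ℝ) {t : ℝ}
    (ht : 0 < t) :
    ∫ x, (y + X x + Z x) ^ 2 ∂μ ≤
      (1 + t) * (y ^ 2 + ∫ x, X x ^ 2 ∂μ) + (1 + 1 / t) * ∫ x, Z x ^ 2 ∂μ := by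
  have h1 : ∀ x, (y + X x + Z x) ^ 2 ≤
      (1 + t) * (y ^ 2 + 2 * y * X x + X x ^ 2) + (1 + 1 / t) * Z x ^ 2 := fun x => by
    have h : 0 ≤ 1 / t * (t * (y + X x) - Z x) ^ 2 := by positivity
    have h' : 1 / t * (t * (y + X x) - Z x) ^ 2 =
        t * (y + X x) ^ 2 - 2 * (y + X x) * Z x + 1 / t * Z x ^ 2 := by field_simp; ring
    nlinarith
  refine (integral_mono .of_finite .of_finite h1).trans_eq ?_
  rw [integral_add .of_finite .of_finite, integral_const_mul, integral_const_mul,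
    integral_add .of_finite .of_finite, integral_add .of_finite .of_finite, integral_const_mul,
    hX, integral_const]
  simp

/-- One growth step changes the second moment by a relative error and an absolute error that are
both of order `n ^ (-3 / 2)`, hence summable. The constant `3000` turns the absolute error into a
relative one; it exceeds `2 * 1280 + 384`, the sum of the contributions of `noise` and `cross`. -/
lemma integral_rescaled_sq_succ_le (q : unitInterval) (n : ℕ) [NeZero n] :
    ∫ ω, rescaled ω ^ 2 ∂law q (n + 1) + 3000 ≤
      (1 + 1 / (n : ℝ) ^ (3 / 2 : ℝ)) * (∫ ω, rescaled ω ^ 2 ∂law q n + 3000) := by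
  have hn1 : (1 : ℝ) ≤ n := by exact_mod_cast NeZero.one_le (n := n)
  have hn : (0 : ℝ) < n := by linarith
  have hD := integral_depthSq_le q (n := n)
  have hD0 : 0 ≤ ∫ ω, depthSq ω ∂law q n :=
    integral_nonneg fun ω => Finset.sum_nonneg fun _ _ => by positivity
  set s : ℝ := (n : ℝ) ^ (3 / 2 : ℝ) with hs
  set D : ℝ := ∫ ω, depthSq ω ∂law q n with hDdef
  set B : ℝ := ∫ ω, rescaled ω ^ 2 ∂law q n with hB
  have hs2 : s ^ 2 = (n : ℝ) ^ 3 := by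
    rw [hs, ← Real.rpow_natCast, ← Real.rpow_mul hn.le, ← Real.rpow_natCast]
    norm_num
  have hs0 : 0 < s := Real.rpow_pos_of_pos hn _
  have hsn : (n : ℝ) ≤ s := by
    rw [hs]
    exact Real.self_le_rpow_of_one_le hn1 (by norm_num)
  set w : ℝ := (n + 1) * (n + 2) with hw
  have hwn : (n : ℝ) ^ 2 ≤ w := by rw [hw]; nlinarith
  have hw0 : 0 < w := by positivity
  -- The weight `1 / s = n ^ (-3 / 2)` is summable, while its inverse is small enough to keep the
  -- contribution of `cross` summable as well.
  have hstep : ∀ ω : Choices n, ∫ c, rescaled (extend ω c) ^ 2 ∂stepLaw q n ≤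
      (1 + 1 / s) * (rescaled ω ^ 2 + (2 / w) ^ 2 * (32 * n * depthSq ω)) +
        (1 + s) * ((1 / w) ^ 2 * (16 * depthSq ω / n + 32)) := fun ω => by
    have h := integral_add_sq_le (stepLaw q n) (fun c => 2 / w * noise ω c)
      (fun c => 1 / w * cross ω c) (by rw [integral_const_mul, integral_noise, mul_zero])
      (rescaled ω) (one_div_pos.2 hs0)
    simp only [rescaled_extend, ← hw]
    refine h.trans ?_
    simp only [mul_pow, integral_const_mul, one_div_one_div]
    gcongr
    · exact integral_noise_sq_le ω q
    · exact integral_cross_sq_le ω q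
  have hmain : ∫ ω, rescaled ω ^ 2 ∂law q (n + 1) ≤
      (1 + 1 / s) * (B + (2 / w) ^ 2 * (32 * n * D)) +
        (1 + s) * ((1 / w) ^ 2 * (16 * D / n + 32)) := by
    rw [integral_law_succ]
    refine (integral_mono .of_finite .of_finite hstep).trans_eq ?_
    rw [integral_add .of_finite .of_finite, integral_const_mul, integral_const_mul,
      integral_add .of_finite .of_finite, integral_const_mul, integral_const_mul,
      integral_const_mul, integral_add .of_finite .of_finite, integral_div, integral_const_mul,
      integral_const]
    simp [hB, hDdef]
  have hw2 : (1 / w) ^ 2 ≤ 1 / (n : ℝ) ^ 4 := by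
    rw [div_pow, one_pow]
    refine one_div_le_one_div_of_le (by positivity) ?_
    calc (n : ℝ) ^ 4 = ((n : ℝ) ^ 2) ^ 2 := by ring
      _ ≤ w ^ 2 := by gcongr
  have e1 : (2 / w) ^ 2 * (32 * n * D) ≤ 1280 * (1 / s) := by
    calc (2 / w) ^ 2 * (32 * n * D) = (1 / w) ^ 2 * (128 * n * D) := by ring
      _ ≤ 1 / (n : ℝ) ^ 4 * (128 * n * (10 * s)) := by gcongr
      _ = 1280 * (s / (n : ℝ) ^ 3) := by field_simp; ring
      _ = 1280 * (1 / s) := by rw [← hs2]; field_simp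
  have e2 : (1 + s) * ((1 / w) ^ 2 * (16 * D / n + 32)) ≤ 384 * (1 / s) := by
    have h32 : (32 : ℝ) ≤ 32 * s / n := by
      rw [le_div_iff₀ hn]; linarith
    calc (1 + s) * ((1 / w) ^ 2 * (16 * D / n + 32))
        ≤ (s + s) * (1 / (n : ℝ) ^ 4 * (16 * (10 * s) / n + 32 * s / n)) := by
          gcongr; linarith
      _ = 384 * (s ^ 2 / (n : ℝ) ^ 3) * (1 / (n : ℝ) ^ 2) := by field_simp; ring
      _ = 384 * (1 / (n : ℝ) ^ 2) := by rw [hs2, div_self (by positivity), mul_one]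
      _ ≤ 384 * (1 / s) := by
          gcongr
          refine (pow_le_pow_iff_left₀ hs0.le (by positivity) two_ne_zero).1 ?_
          rw [hs2, ← pow_mul]
          exact pow_le_pow_right₀ hn1 (by norm_num)
  have hs1 : 1 / s ≤ 1 := by
    rw [div_le_one hs0]; linarith
  have hs1' : 0 < 1 / s := one_div_pos.2 hs0
  nlinarith [mul_le_mul_of_nonneg_left e1 (by linarith : 0 ≤ 1 + 1 / s)]

/-- A discrete Grönwall bound. -/
lemma exists_bound_of_succ_le_one_add_mul {a t : ℕ → ℝ} (ht : ∀ n, 0 ≤ t n) (hsum : Summable t)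
    (ha : 0 ≤ a 1) (h : ∀ n, 1 ≤ n → a (n + 1) ≤ (1 + t n) * a n) :
    ∃ C, ∀ n, 1 ≤ n → a n ≤ C := by
  have key : ∀ n, 1 ≤ n → a n ≤ Real.exp (∑ k ∈ Finset.range n, t k) * a 1 := by
    intro n hn
    induction n, hn using Nat.le_induction with
    | base =>
      have : 1 ≤ Real.exp (∑ k ∈ Finset.range 1, t k) :=
        Real.one_le_exp (Finset.sum_nonneg fun k _ => ht k)
      nlinarith
    | succ n hn ih =>
      calc a (n + 1) ≤ (1 + t n) * a n := h n hn
        _ ≤ (1 + t n) * (Real.exp (∑ k ∈ Finset.range n, t k) * a 1) :=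
          mul_le_mul_of_nonneg_left ih (by linarith [ht n])
        _ ≤ Real.exp (t n) * (Real.exp (∑ k ∈ Finset.range n, t k) * a 1) := by
          gcongr
          linarith [Real.add_one_le_exp (t n)]
        _ = _ := by rw [Finset.sum_range_succ, Real.exp_add]; ring
  refine ⟨Real.exp (∑' k, t k) * a 1, fun n hn => (key n hn).trans ?_⟩
  gcongr
  exact hsum.sum_le_tsum _ fun k _ => ht k

lemma exists_integral_rescaled_sq_le (q : unitInterval) :
    ∃ C, ∀ n, 1 ≤ n → ∫ ω, rescaled ω ^ 2 ∂law q n ≤ C := by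
  obtain ⟨C, hC⟩ := exists_bound_of_succ_le_one_add_mul
    (a := fun n => ∫ ω, rescaled ω ^ 2 ∂law q n + 3000)
    (t := fun n => 1 / (n : ℝ) ^ (3 / 2 : ℝ)) (fun n => by positivity)
    (Real.summable_one_div_nat_rpow.2 (by norm_num))
    (add_nonneg (integral_nonneg fun ω => sq_nonneg _) (by norm_num))
    (fun n hn => by
      have : NeZero n := ⟨by omega⟩
      exact integral_rescaled_sq_succ_le q n)
  exact ⟨C, fun n hn => by linarith [hC n hn]⟩

lemma variance_S_le (q : unitInterval) (n : ℕ) [NeZero n] :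
    variance (S n) (law q n) ≤ (n : ℝ) ^ 4 * ∫ ω, rescaled ω ^ 2 ∂law q n := by
  have hn1 : (1 : ℝ) ≤ n := by exact_mod_cast NeZero.one_le (n := n)
  have hS : ∀ ω, S n ω - n * (n + 1) / 2 * centre n = n * (n + 1) / 2 * rescaled ω := fun ω => by
    rw [S_eq, rescaled]
    field_simp
  have hI : 0 ≤ ∫ ω, rescaled ω ^ 2 ∂law q n := integral_nonneg fun ω => sq_nonneg _
  rw [← variance_sub_const (X := S n) .of_discrete (n * (n + 1) / 2 * centre n)]
  refine (variance_le_expectation_sq .of_discrete).trans ?_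
  simp only [Pi.pow_apply, hS, mul_pow, integral_const_mul]
  gcongr
  calc ((n : ℝ) * (n + 1) / 2) ^ 2 ≤ ((n : ℝ) ^ 2) ^ 2 := by gcongr; nlinarith
    _ = (n : ℝ) ^ 4 := by ring

end BCMRT

theorem mainTheorem8 (q : unitInterval) (hq : (q : ℝ) ≤ 1 / 2) :
    (fun n : ℕ => variance (BCMRT.S n) (BCMRT.law q n)) =O[atTop] (fun n : ℕ => (n : ℝ) ^ 4) := by
  obtain ⟨C, hC⟩ := BCMRT.exists_integral_rescaled_sq_le q
  refine IsBigO.of_bound C ?_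
  filter_upwards [eventually_ge_atTop 1] with n hn
  have : NeZero n := ⟨by omega⟩
  rw [Real.norm_of_nonneg (variance_nonneg _ _), Real.norm_of_nonneg (by positivity), mul_comm]
  exact (BCMRT.variance_S_le q n).trans (by gcongr; exact hC n hn)
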